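/- **Proposition (2-structure equation).** All Lie groups and manifolds are smooth, finite-dimensional and real. Let $\mathcal G=(\partial\colon E\to G,\triangleright)$ be a Lie crossed module: $G$ and $E$ are Lie groups, $\partial$ is a smooth homomorphism, and $\triangleright$ is a smooth left action of $G$ on $E$ by automorphisms with $\partial(g\triangleright e)=g\,\partial(e)\,g^{-1}$ and $\partial(e)\triangleright f=efe^{-1}$. Let $\mathfrak g,\mathfrak e$ be the Lie algebras; write again $\partial\colon\mathfrak e\to\mathfrak g$ for the derivative of $\partial$ at $1$, $g\triangleright x$ ($g\in G$, $x\in\mathfrak e$) for the derivative at $1$ of $e\mapsto g\triangleright e$, and $A\triangleright x$ ($A\in\mathfrak g$, $x\in\mathfrak e$) for the derived action of $\mathfrak g$ on $\mathfrak e$. Let $P\to M$ be a smooth principal $G$-bundle with right action $R_g$, and let $A^\#$ be the fundamental vector field on $P$ of $A\in\mathfrak g$, $A^\#_u=\frac{d}{dt}\big|_{t=0}u\exp(tA)$. A connection $1$-form is a smooth $\mathfrak g$-valued $1$-form $\omega$ on $P$ with $R_g^*\omega=g^{-1}\omega g$ and $\omega(A^\#)=A$. For such $\omega$ let $H\colon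 X\mapsto X^H=X-\omega(X)^\#$ be the horizontal projection, that is, the projection of each tangent space of $P$ onto $\ker\omega$ along the vertical vectors. For a form $a$ of degree $n$ put $Da=da\circ(H\times\cdots\times H)$ ($n+1$ factors), call $a$ horizontal if $a=a\circ(H\times\cdots\times H)$, and, if $a$ is $\mathfrak e$-valued, call it $G$-equivariant if $R_g^*a=g^{-1}\triangleright a$ for all $g\in G$. The curvature of $\omega$ is $\Omega=D\omega$. A $\mathcal G$-categorical connection on $P$ is a pair $(\omega,m)$ of a connection $1$-form $\omega$ and a smooth, $G$-equivariant, horizontal $\mathfrak e$-valued $2$-form $m$ on $P$ with $\partial(m)=\Omega$; its $2$-curvature is the $3$-form $\mathcal M=Dm=dm\circ(H\times H\times H)$. For a $\mathfrak g$-valued $k$-form $a$ and an $\mathfrak e$-valued $l$-form $b$ put $$a\wedge^\triangleright b=\frac{(k+l)!}{k!\,l!}\,\mathrm{Alt}(a\otimes^\triangleright b),\qquad (a\otimes^\triangleright b)(A_1,\dots,A_k,B_1,\dots,B_l)=a(A_1,\dots,A_k)\triangleright b(B_1,\dots,B_l),$$ where $\mathrm{Alt}$ is the projection onto alternating tensors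 and $d$ is normalised so that $da(X,Y)=X(a(Y))-Y(a(X))-a([X,Y])$ for $1$-forms $a$. 1. If $(\omega,m)$ is a $\mathcal G$-categorical connection on $P$, then $$\mathcal M=dm+\omega\wedge^\triangleright m,$$ and $\mathcal M$ is $G$-equivariant: $R_g^*\mathcal M=g^{-1}\triangleright\mathcal M$ for all $g\in G$. 2. More generally, if $\omega$ is a connection $1$-form on $P$ and $a$ is a smooth, $G$-equivariant, horizontal $\mathfrak e$-valued $n$-form on $P$, $n\ge 0$, then $$Da=da+\omega\wedge^\triangleright a.$$ -/

import Mathlib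

open scoped Manifold ContDiff

noncomputable section

/-! ### Differential forms on manifolds -/

section Forms

variable {V : Type*} [NormedAddCommGroup V] [NormedSpace ℝ V]
  {V' : Type*} [NormedAddCommGroup V'] [NormedSpace ℝ V']
  {F : Type*} [NormedAddCommGroup F] [NormedSpace ℝ F]
  {F' : Type*} [NormedAddCommGroup F'] [NormedSpace ℝ F']
  {F'' : Type*} [NormedAddCommGroup F''] [NormedSpace ℝ F'']

/-- A (not necessarily smooth) differential `n`-form with values in `F` on a manifold `X` modelled
on the vector space `V`. -/
abbrev DForm (V : Type*) [NormedAddCommGroup V] [NormedSpace ℝ V]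
    (X : Type*) [TopologicalSpace X] [ChartedSpace V X]
    (n : ℕ) (F : Type*) [NormedAddCommGroup F] [NormedSpace ℝ F] : Type _ :=
  ∀ x : X, TangentSpace 𝓘(ℝ, V) x [⋀^Fin n]→L[ℝ] F

variable {X : Type*} [TopologicalSpace X] [ChartedSpace V X]
  {Y : Type*} [TopologicalSpace Y] [ChartedSpace V' Y] {n : ℕ}

/-- The pull-back `f^* a` of a form. -/
def DForm.pullback (f : X → Y) (a : DForm V' Y n F) : DForm V X n F := fun x =>
  (a (f x)).compContinuousLinearMap (mfderiv 𝓘(ℝ, V) 𝓘(ℝ, V') f x)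

/-- The expression of a form in the preferred chart around `x₀`, that is, its pull-back along the
inverse of that chart. It is meaningful on the target of the chart only. -/
def DForm.chartRep (a : DForm V X n F) (x₀ : X) : V → V [⋀^Fin n]→L[ℝ] F := fun y =>
  (a ((extChartAt 𝓘(ℝ, V) x₀).symm y)).compContinuousLinearMap
    (mfderiv 𝓘(ℝ, V) 𝓘(ℝ, V) (extChartAt 𝓘(ℝ, V) x₀).symm y)

/-- A form is smooth if its expressions in charts are smooth. -/
def DForm.IsSmooth (a : DForm V X n F) : Prop :=
  ∀ x₀ : X, ContDiffOn ℝ ∞ (a.chartRep x₀) (extChartAt 𝓘(ℝ, V) x₀).target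

/-- The exterior derivative `da`, with the normalisation
`da (X₀, …, Xₙ) = ∑ (-1)^i X_i (a (…, X̂_i, …)) + ∑_{i<j} (-1)^(i+j) a ([X_i, X_j], …)`; at the point
`x` it is computed in the preferred chart around `x` and carried back to `X`. -/
def DForm.d (a : DForm V X n F) : DForm V X (n + 1) F := fun x =>
  (extDeriv (a.chartRep x) (extChartAt 𝓘(ℝ, V) x x)).compContinuousLinearMap
    (mfderiv 𝓘(ℝ, V) 𝓘(ℝ, V) (extChartAt 𝓘(ℝ, V) x) x)

/-- Application of a linear map to the values of a form. -/
def DForm.map (L : F →L[ℝ] F') (a : DForm V X n F) : DForm V X n F' := fun x =>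
  L.compContinuousAlternatingMap (a x)

/-- The linear map `v ↦ a (v)` given by a `1`-form at a point. -/
def DForm.toLin (a : DForm V X 1 F) (x : X) : TangentSpace 𝓘(ℝ, V) x →L[ℝ] F :=
  (ContinuousAlternatingMap.ofSubsingleton ℝ (TangentSpace 𝓘(ℝ, V) x) F (0 : Fin 1)).symm (a x)

theorem DForm.toLin_apply (a : DForm V X 1 F) (x : X) (v : TangentSpace 𝓘(ℝ, V) x) :
    a.toLin x v = a x ![v] := by
  simp only [DForm.toLin, ContinuousAlternatingMap.ofSubsingleton_symm_apply_apply]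
  congr 1
  ext i
  fin_cases i
  rfl

variable {k l N : ℕ}

theorem DForm.update_castAdd_left {T : Type*} (v : Fin (k + l) → T) (i : Fin k) (x : T) :
    (fun i' : Fin k => Function.update v (Fin.castAdd l i) x (Fin.castAdd l i')) =
      Function.update (fun i' => v (Fin.castAdd l i')) i x := by
  ext i'
  by_cases h : i' = i
  · subst h; simp
  · have : Fin.castAdd l i' ≠ Fin.castAdd l i := fun h' => h (Fin.castAdd_injective _ _ h')
    simp [h, this]

theorem DForm.update_castAdd_right {T : Type*} (v : Fin (k + l) → T) (i : Fin k) (x : T) :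
    (fun j : Fin l => Function.update v (Fin.castAdd l i) x (Fin.natAdd k j)) =
      fun j => v (Fin.natAdd k j) := by
  ext j
  have : Fin.natAdd k j ≠ Fin.castAdd l i := by
    intro h'
    have := congrArg Fin.val h'
    simp only [Fin.val_natAdd, Fin.val_castAdd] at this
    omega
  simp [this]

theorem DForm.update_natAdd_left {T : Type*} (v : Fin (k + l) → T) (j : Fin l) (x : T) :
    (fun i : Fin k => Function.update v (Fin.natAdd k j) x (Fin.castAdd l i)) =
      fun i => v (Fin.castAdd l i) := by
  ext i
  have : Fin.castAdd l i ≠ Fin.natAdd k j := by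
    intro h'
    have := congrArg Fin.val h'
    simp only [Fin.val_natAdd, Fin.val_castAdd] at this
    omega
  simp [this]

theorem DForm.update_natAdd_right {T : Type*} (v : Fin (k + l) → T) (j : Fin l) (x : T) :
    (fun j' : Fin l => Function.update v (Fin.natAdd k j) x (Fin.natAdd k j')) =
      Function.update (fun j' => v (Fin.natAdd k j')) j x := by
  ext j'
  by_cases h : j' = j
  · subst h; simp
  · have : Fin.natAdd k j' ≠ Fin.natAdd k j := fun h' => h (Fin.natAdd_injective _ _ h')
    simp [h, this]

/-- The covariant tensor field `a ⊗^β b` of degree `N = k + l`,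
`(A₁, …, A_k, B₁, …, B_l) ↦ β (a (A₁, …, A_k), b (B₁, …, B_l))`, at a point, for a bilinear map `β`.
The two groups of arguments are the images of `Fin k` and of `Fin l` in `Fin N`. -/
def DForm.tensorAt (β : F →L[ℝ] F' →L[ℝ] F'') (a : DForm V X k F) (b : DForm V X l F')
    (h : k + l = N) (x : X) :
    ContinuousMultilinearMap ℝ (fun _ : Fin N => TangentSpace 𝓘(ℝ, V) x) F'' where
  toFun v := β (a x fun i => v (Fin.cast h (Fin.castAdd l i)))
    (b x fun j => v (Fin.cast h (Fin.natAdd k j)))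
  map_update_add' := by
    intro _ v i x y
    subst h
    obtain rfl : ‹DecidableEq (Fin (k + l))› = instDecidableEqFin (k + l) := Subsingleton.elim _ _
    refine Fin.addCases (fun i => ?_) (fun j => ?_) i
    · simp only [Fin.cast_refl, id_eq, DForm.update_castAdd_left, DForm.update_castAdd_right,
        ContinuousAlternatingMap.map_update_add, map_add, add_apply]
    · simp only [Fin.cast_refl, id_eq, DForm.update_natAdd_left, DForm.update_natAdd_right,
        ContinuousAlternatingMap.map_update_add, map_add]
  map_update_smul' := by
    intro _ v i c x
    subst h
    obtain rfl : ‹DecidableEq (Fin (k + l))› = instDecidableEqFin (k + l) := Subsingleton.elim _ _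
    refine Fin.addCases (fun i => ?_) (fun j => ?_) i
    · simp only [Fin.cast_refl, id_eq, DForm.update_castAdd_left, DForm.update_castAdd_right,
        ContinuousAlternatingMap.map_update_smul, map_smul, smul_apply]
    · simp only [Fin.cast_refl, id_eq, DForm.update_natAdd_left, DForm.update_natAdd_right,
        ContinuousAlternatingMap.map_update_smul, map_smul]
  cont := by
    have h1 : Continuous fun v : Fin N → TangentSpace 𝓘(ℝ, V) x =>
        a x fun i => v (Fin.cast h (Fin.castAdd l i)) :=
      (a x).cont.comp (continuous_pi fun i => continuous_apply _)
    have h2 : Continuous fun v : Fin N → TangentSpace 𝓘(ℝ, V) x =>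
        b x fun j => v (Fin.cast h (Fin.natAdd k j)) :=
      (b x).cont.comp (continuous_pi fun i => continuous_apply _)
    exact (β.continuous.comp h1).clm_apply h2

/-- The form `a ∧^β b = (k + l)! / (k! l!) Alt (a ⊗^β b)` of degree `N = k + l`, where `Alt` is the
projection `T ↦ (1 / N!) ∑_σ sign σ • T ∘ σ` onto alternating tensors. -/
def DForm.wedge (β : F →L[ℝ] F' →L[ℝ] F'') (a : DForm V X k F) (b : DForm V X l F')
    (h : k + l = N) : DForm V X N F'' := fun x =>
  (((k + l).factorial : ℝ) / ((k.factorial : ℝ) * (l.factorial : ℝ))) •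
    ((N.factorial : ℝ)⁻¹ • (DForm.tensorAt β a b h x).alternatization)

end Forms

/-! ### Lie groups and crossed modules -/

/-- The Lie algebra of a Lie group `G` modelled on `V`, as a normed space: the tangent space
of `G` at `1` is, by definition, a copy of the model space `V`. -/
abbrev LieAlg (V : Type*) (G : Type*) [NormedAddCommGroup V] [NormedSpace ℝ V]
    [TopologicalSpace G] [ChartedSpace V G] [Group G] : Type _ := V

theorem groupLieAlgebra_eq_lieAlg (V : Type*) (G : Type*) [NormedAddCommGroup V] [NormedSpace ℝ V]
    [TopologicalSpace G] [ChartedSpace V G] [Group G] :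
    GroupLieAlgebra 𝓘(ℝ, V) G = LieAlg V G := rfl

section Groups

variable {VG : Type*} [NormedAddCommGroup VG] [NormedSpace ℝ VG]
  {G : Type*} [TopologicalSpace G] [ChartedSpace VG G] [Group G]
  {VE : Type*} [NormedAddCommGroup VE] [NormedSpace ℝ VE]
  {E : Type*} [TopologicalSpace E] [ChartedSpace VE E] [Group E]

/-- The adjoint action of `G` on its Lie algebra, `A ↦ g A g⁻¹`: the derivative at `1` of
conjugation by `g`. -/
def adjointAction (VG : Type*) [NormedAddCommGroup VG] [NormedSpace ℝ VG]
    {G : Type*} [TopologicalSpace G] [ChartedSpace VG G] [Group G] (g : G) :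
    LieAlg VG G →L[ℝ] LieAlg VG G :=
  mfderiv 𝓘(ℝ, VG) 𝓘(ℝ, VG) (fun h : G => g * h * g⁻¹) 1

/-- A Lie crossed module `(∂ : E → G, ▷)`. -/
structure LieCrossedModule (VG : Type*) [NormedAddCommGroup VG] [NormedSpace ℝ VG]
    (G : Type*) [TopologicalSpace G] [ChartedSpace VG G] [Group G]
    (VE : Type*) [NormedAddCommGroup VE] [NormedSpace ℝ VE]
    (E : Type*) [TopologicalSpace E] [ChartedSpace VE E] [Group E] where
  /-- The boundary map `∂`. -/
  bdry : E →* G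
  /-- The left action `▷` of `G` on `E` by automorphisms. -/
  act : G →* MulAut E
  bdry_act : ∀ (g : G) (e : E), bdry (act g e) = g * bdry e * g⁻¹
  act_bdry : ∀ e f : E, act (bdry e) f = e * f * e⁻¹
  contMDiff_bdry : ContMDiff 𝓘(ℝ, VE) 𝓘(ℝ, VG) ∞ bdry
  contMDiff_act : ContMDiff (𝓘(ℝ, VG).prod 𝓘(ℝ, VE)) 𝓘(ℝ, VE) ∞ fun p : G × E => act p.1 p.2

namespace LieCrossedModule

variable (C : LieCrossedModule VG G VE E)

/-- The map `∂` on Lie algebras: the derivative at `1` of `∂ : E → G`. -/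
def lieBdry : LieAlg VE E →L[ℝ] LieAlg VG G :=
  mfderiv 𝓘(ℝ, VE) 𝓘(ℝ, VG) C.bdry 1

/-- The action `x ↦ g ▷ x` of the group `G` on the Lie algebra of `E`: the derivative at `1` of
`e ↦ g ▷ e`. -/
def groupAct (g : G) : LieAlg VE E →L[ℝ] LieAlg VE E :=
  mfderiv 𝓘(ℝ, VE) 𝓘(ℝ, VE) (fun e : E => C.act g e) 1

/-- The derived action `(A, x) ↦ A ▷ x` of the Lie algebra of `G` on the Lie algebra of `E`: the
derivative of `g ↦ (x ↦ g ▷ x)` at `1` in the direction `A`. -/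
def lieAct : LieAlg VG G →L[ℝ] LieAlg VE E →L[ℝ] LieAlg VE E :=
  mfderiv 𝓘(ℝ, VG) 𝓘(ℝ, LieAlg VE E →L[ℝ] LieAlg VE E) C.groupAct 1

end LieCrossedModule

end Groups

/-! ### Principal bundles and connections -/

/-- A smooth principal `G`-bundle `P → M`: a smooth right action of `G` on `P` which preserves the
fibres of `proj`, together with (the existence of) smooth `G`-equivariant local
trivialisations. -/
structure SmoothPrincipalBundle (VG : Type*) [NormedAddCommGroup VG] [NormedSpace ℝ VG]
    (G : Type*) [TopologicalSpace G] [ChartedSpace VG G] [Group G]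
    (VM : Type*) [NormedAddCommGroup VM] [NormedSpace ℝ VM]
    (M : Type*) [TopologicalSpace M] [ChartedSpace VM M]
    (VP : Type*) [NormedAddCommGroup VP] [NormedSpace ℝ VP]
    (P : Type*) [TopologicalSpace P] [ChartedSpace VP P] where
  /-- The projection `π`. -/
  proj : P → M
  /-- The right action, `R g u = u g`. -/
  R : G → P → P
  R_one : ∀ u, R 1 u = u
  R_mul : ∀ g h u, R (g * h) u = R h (R g u)
  contMDiff_proj : ContMDiff 𝓘(ℝ, VP) 𝓘(ℝ, VM) ∞ proj
  contMDiff_R : ContMDiff (𝓘(ℝ, VP).prod 𝓘(ℝ, VG)) 𝓘(ℝ, VP) ∞ fun p : P × G => R p.2 p.1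
  proj_R : ∀ g u, proj (R g u) = proj u
  locally_trivial : ∀ x : M, ∃ e : Bundle.Trivialization G proj, x ∈ e.baseSet ∧
    ContMDiffOn 𝓘(ℝ, VP) (𝓘(ℝ, VM).prod 𝓘(ℝ, VG)) ∞ e e.source ∧
    ContMDiffOn (𝓘(ℝ, VM).prod 𝓘(ℝ, VG)) 𝓘(ℝ, VP) ∞ e.toOpenPartialHomeomorph.symm e.target ∧
    ∀ u ∈ e.source, ∀ g, e (R g u) = ((e u).1, (e u).2 * g)

namespace SmoothPrincipalBundle

variable {VG : Type*} [NormedAddCommGroup VG] [NormedSpace ℝ VG]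
  {G : Type*} [TopologicalSpace G] [ChartedSpace VG G] [Group G]
  {VE : Type*} [NormedAddCommGroup VE] [NormedSpace ℝ VE]
  {E : Type*} [TopologicalSpace E] [ChartedSpace VE E] [Group E]
  {VM : Type*} [NormedAddCommGroup VM] [NormedSpace ℝ VM]
  {M : Type*} [TopologicalSpace M] [ChartedSpace VM M]
  {VP : Type*} [NormedAddCommGroup VP] [NormedSpace ℝ VP]
  {P : Type*} [TopologicalSpace P] [ChartedSpace VP P]
  {F : Type*} [NormedAddCommGroup F] [NormedSpace ℝ F]
  (B : SmoothPrincipalBundle VG G VM M VP P) {n : ℕ}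

/-- The fundamental vector fields, `A^#_u = d/dt (u exp (tA))` at `t = 0`: the derivative at `1` of
`g ↦ u g` in the direction `A`. -/
def fund (u : P) : LieAlg VG G →L[ℝ] TangentSpace 𝓘(ℝ, VP) u :=
  mfderiv 𝓘(ℝ, VG) 𝓘(ℝ, VP) (fun g : G => B.R g u) 1

/-- `θ` is a connection `1`-form on the bundle: it is smooth, `R_g^* θ = g⁻¹ θ g` and
`θ (A^#) = A`. -/
structure IsConnection (θ : DForm VP P 1 (LieAlg VG G)) : Prop where
  smooth : θ.IsSmooth
  equivariant : ∀ g : G, θ.pullback (B.R g) = θ.map (adjointAction VG g⁻¹)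
  apply_fund : ∀ (u : P) (A : LieAlg VG G), θ u ![B.fund u A] = A

/-- The horizontal projection `X ↦ X^H = X - θ(X)^#`: the projection of the tangent space onto
the kernel of `θ` along the vertical vectors. -/
def horProj (θ : DForm VP P 1 (LieAlg VG G)) (u : P) :
    TangentSpace 𝓘(ℝ, VP) u →L[ℝ] TangentSpace 𝓘(ℝ, VP) u :=
  ContinuousLinearMap.id ℝ (TangentSpace 𝓘(ℝ, VP) u) - (B.fund u).comp (θ.toLin u)

/-- `X^H` is horizontal. -/
theorem apply_horProj {θ : DForm VP P 1 (LieAlg VG G)} (hθ : B.IsConnection θ) (u : P)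
    (v : TangentSpace 𝓘(ℝ, VP) u) : θ.toLin u (B.horProj θ u v) = 0 := by
  have h := hθ.apply_fund u (θ.toLin u v)
  rw [← DForm.toLin_apply] at h
  simp only [horProj, sub_apply, ContinuousLinearMap.id_apply,
    ContinuousLinearMap.comp_apply, map_sub]
  rw [h, sub_self]

/-- The fundamental vector fields, hence the differences `X - X^H = θ(X)^#`, are vertical. -/
theorem mfderiv_proj_fund [LieGroup 𝓘(ℝ, VG) ∞ G] (u : P) (A : LieAlg VG G) :
    mfderiv 𝓘(ℝ, VP) 𝓘(ℝ, VM) B.proj u (B.fund u A) = 0 := by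
  have hR : MDifferentiableAt 𝓘(ℝ, VG) 𝓘(ℝ, VP) (fun g : G => B.R g u) 1 := by
    have h1 : ContMDiff 𝓘(ℝ, VG) 𝓘(ℝ, VP) ∞ (fun g : G => B.R g u) :=
      B.contMDiff_R.comp (contMDiff_const.prodMk contMDiff_id)
    exact (h1 1).mdifferentiableAt (by simp)
  have hp : MDifferentiableAt 𝓘(ℝ, VP) 𝓘(ℝ, VM) B.proj (B.R 1 u) :=
    (B.contMDiff_proj _).mdifferentiableAt (by simp)
  have h := mfderiv_comp (1 : G) hp hR
  have hc : B.proj ∘ (fun g : G => B.R g u) = fun _ => B.proj u := by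
    ext g; exact B.proj_R g u
  rw [hc, mfderiv_const, B.R_one] at h
  exact (DFunLike.congr_fun h A).symm

/-- The form `a ∘ (H × ⋯ × H)`. -/
def horPart (θ : DForm VP P 1 (LieAlg VG G)) (a : DForm VP P n F) : DForm VP P n F := fun u =>
  (a u).compContinuousLinearMap (B.horProj θ u)

/-- A form is horizontal if `a (X₁, …, Xₙ) = a (X₁^H, …, Xₙ^H)`. -/
def IsHorizontal (θ : DForm VP P 1 (LieAlg VG G)) (a : DForm VP P n F) : Prop :=
  a = B.horPart θ a

/-- The exterior covariant derivative `Da = da ∘ (H × ⋯ × H)`. -/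
def covD (θ : DForm VP P 1 (LieAlg VG G)) (a : DForm VP P n F) : DForm VP P (n + 1) F :=
  B.horPart θ a.d

/-- The curvature `2`-form `Ω = Dθ` of a connection. -/
def curvature (θ : DForm VP P 1 (LieAlg VG G)) : DForm VP P 2 (LieAlg VG G) :=
  B.covD θ θ

/-- `a` is `G`-equivariant: `R_g^* a = g⁻¹ ▷ a` for all `g`. -/
def IsEquivariant (C : LieCrossedModule VG G VE E) (a : DForm VP P n (LieAlg VE E)) : Prop :=
  ∀ g : G, a.pullback (B.R g) = a.map (C.groupAct g⁻¹)

/-- `(θ, m)` is a categorical connection for the Lie crossed module `C`: `θ` is a connection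
`1`-form and `m` is a smooth, `G`-equivariant, horizontal `2`-form with `∂ (m) = Ω`. -/
structure IsCategoricalConnection (C : LieCrossedModule VG G VE E)
    (θ : DForm VP P 1 (LieAlg VG G)) (m : DForm VP P 2 (LieAlg VE E)) : Prop where
  isConnection : B.IsConnection θ
  smooth : m.IsSmooth
  equivariant : B.IsEquivariant C m
  horizontal : B.IsHorizontal θ m
  bdry_eq_curvature : m.map C.lieBdry = B.curvature θ

/-- The `2`-curvature `3`-form `dm ∘ (H × H × H)` of a categorical connection `(θ, m)`. -/
def twoCurvature (θ : DForm VP P 1 (LieAlg VG G)) (m : DForm VP P 2 (LieAlg VE E)) :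
    DForm VP P 3 (LieAlg VE E) :=
  B.covD θ m

end SmoothPrincipalBundle

end

/-!
# The structure equation for the 2-curvature of a categorical connection

For an equivariant horizontal form `a` the form `η = da + θ ∧ a` is annihilated by every
fundamental vector field `A^#`. Indeed, since `i_{A^#} a = 0`, Cartan's formula says that
`i_{A^#} da` is the Lie derivative of `a` along `A^#`, which is `-(A ▷ a)` by equivariance
(`SmoothPrincipalBundle.d_cons_fund`), while `i_{A^#} (θ ∧ a) = θ(A^#) ▷ a = A ▷ a`
(`DForm.wedge_one_apply_cons`). As `X - X^H` is always a value of a fundamental vector field, `η`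
does not change when its arguments are replaced by their horizontal parts; and then only `da`
survives, because `θ` vanishes on horizontal vectors. Hence `η = Da`
(`SmoothPrincipalBundle.covD_eq`).

Flows and Lie derivatives are avoided in the proof of Cartan's formula. In charts around `1 ∈ G` and
around a point `u` of the bundle, the right action is a smooth map `Ψ` from an open subset of
`VG × VP` to `VP`, and `extDeriv_cons_of_equivariant` evaluates `d(Ψ^* α) = Ψ^* dα` on one vector
`(A, 0)` and on vectors `(0, v i)`, where `α` is the coordinate expression of `a`. The derivative in
the direction `(A, 0)` is given by equivariance, and the derivatives in the directions `(0, v i)` are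
zero because `α` annihilates the fundamental vector fields.

The equivariance of `Da` follows from the naturality of the exterior derivative (`DForm.d_pullback`,
`DForm.d_map`) and from the fact that the horizontal projection commutes with the right action
(`SmoothPrincipalBundle.mfderiv_R_horProj`).
-/

open scoped Topology

/-! ### Alternating maps and wedge products with a one-form -/

section Alternating

variable {W : Type*} [AddCommGroup W] [Module ℝ W] [TopologicalSpace W]
  {F : Type*} [NormedAddCommGroup F] [NormedSpace ℝ F] {n : ℕ}

theorem ContinuousAlternatingMap.eq_zero_of_mem_of_cons_eq_zero (f : W [⋀^Fin (n + 1)]→L[ℝ] F)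
    {S : Set W} (hf : ∀ e ∈ S, ∀ v : Fin n → W, f (Fin.cons e v) = 0) (v : Fin (n + 1) → W)
    (i : Fin (n + 1)) (hi : v i ∈ S) : f v = 0 := by
  have h : f (v ∘ Equiv.swap 0 i) = Equiv.Perm.sign (Equiv.swap 0 i) • f v := f.map_perm v _
  have h0 : f (v ∘ Equiv.swap 0 i) = 0 := by
    rw [← Fin.cons_self_tail (v ∘ Equiv.swap 0 i)]
    exact hf _ (by simpa using hi) _
  rw [h0] at h
  rcases Int.units_eq_one_or (Equiv.Perm.sign (Equiv.swap 0 i)) with hs | hs <;>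
    simpa [hs] using h.symm

/-- An alternating map which vanishes as soon as its first argument lies in the range of `K` does
not change when each argument `w` is replaced by `w - K w`. -/
theorem ContinuousAlternatingMap.map_sub_comp_eq_of_cons_eq_zero (f : W [⋀^Fin (n + 1)]→L[ℝ] F)
    (K : W → W) (hf : ∀ w, ∀ v : Fin n → W, f (Fin.cons (K w) v) = 0)
    (v : Fin (n + 1) → W) : f (fun i => v i - K (v i)) = f v := by
  have h : f ((fun i => v i - K (v i)) + fun i => K (v i)) = ∑ s : Finset (Fin (n + 1)),
      f (s.piecewise (fun i => v i - K (v i)) fun i => K (v i)) :=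
    f.toContinuousMultilinearMap.map_add_univ _ _
  have h2 : ((fun i => v i - K (v i)) + fun i => K (v i)) = v := by ext i; simp
  rw [h2] at h
  refine Eq.trans ?_ h.symm
  rw [Finset.sum_eq_single Finset.univ]
  · congr 1
    ext i
    simp
  -- in the other terms of the multilinear expansion some argument is a value of `K`
  · intro s _ hs
    obtain ⟨i, hi⟩ : ∃ i, i ∉ s := by
      by_contra! hc
      exact hs (Finset.eq_univ_iff_forall.2 hc)
    refine f.eq_zero_of_mem_of_cons_eq_zero (S := Set.range K) ?_ _ i ?_
    · rintro _ ⟨w, rfl⟩ u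
      exact hf w u
    · simp [Finset.piecewise_eq_of_notMem _ _ _ hi]
  · simp

end Alternating

section Wedge

variable {V : Type*} [NormedAddCommGroup V] [NormedSpace ℝ V]
  {F : Type*} [NormedAddCommGroup F] [NormedSpace ℝ F]
  {F' : Type*} [NormedAddCommGroup F'] [NormedSpace ℝ F']
  {F'' : Type*} [NormedAddCommGroup F''] [NormedSpace ℝ F'']
  {X : Type*} [TopologicalSpace X] [ChartedSpace V X] {n : ℕ}

/-- The normalising factors of the wedge product with a `1`-form reduce to `1 / n!`. -/
theorem DForm.wedge_one_apply (β : F →L[ℝ] F' →L[ℝ] F'') (a : DForm V X 1 F) (b : DForm V X n F')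
    (x : X) (v : Fin (n + 1) → TangentSpace 𝓘(ℝ, V) x) :
    DForm.wedge β a b (Nat.add_comm 1 n) x v = (n.factorial : ℝ)⁻¹ •
      ∑ σ : Equiv.Perm (Fin (n + 1)), Equiv.Perm.sign σ •
        β (a.toLin x (v (σ 0))) (b x fun j => v (σ j.succ)) := by
  have h : ((1 + n).factorial : ℝ) / (((1 : ℕ).factorial : ℝ) * (n.factorial : ℝ)) *
      ((n + 1).factorial : ℝ)⁻¹ = (n.factorial : ℝ)⁻¹ := by
    rw [Nat.add_comm 1 n, Nat.factorial_one, Nat.cast_one, one_mul]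
    have := Nat.cast_ne_zero (R := ℝ).2 (Nat.factorial_ne_zero (n + 1))
    have := Nat.cast_ne_zero (R := ℝ).2 (Nat.factorial_ne_zero n)
    field_simp
  have h2 : DForm.wedge β a b (Nat.add_comm 1 n) x v =
      (((1 + n).factorial : ℝ) / (((1 : ℕ).factorial : ℝ) * (n.factorial : ℝ))) •
      ((n + 1).factorial : ℝ)⁻¹ •
        (DForm.tensorAt β a b (Nat.add_comm 1 n) x).alternatization v := rfl
  rw [h2, smul_smul, h, ContinuousMultilinearMap.alternatization_apply_apply]
  congr 1
  refine Finset.sum_congr rfl fun σ _ => ?_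
  congr 1
  have h3 : ∀ w : Fin (n + 1) → TangentSpace 𝓘(ℝ, V) x,
      DForm.tensorAt β a b (Nat.add_comm 1 n) x w =
      β (a x fun i => w (Fin.cast (Nat.add_comm 1 n) (Fin.castAdd n i)))
        (b x fun j => w (Fin.cast (Nat.add_comm 1 n) (Fin.natAdd 1 j))) := fun _ => rfl
  rw [h3, DForm.toLin_apply]
  congr 2
  · congr 2
    ext i
    fin_cases i
    rfl
  · ext j
    simp only [Function.comp_apply]
    congr 2
    ext
    simp

/-- Contraction of `a ∧^β b` with a vector `e` which is annihilated by `b`. -/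
theorem DForm.wedge_one_apply_cons (β : F →L[ℝ] F' →L[ℝ] F'') (a : DForm V X 1 F)
    (b : DForm V X n F') (x : X) (e : TangentSpace 𝓘(ℝ, V) x)
    (hb : ∀ v : Fin n → TangentSpace 𝓘(ℝ, V) x, (∃ i, v i = e) → b x v = 0)
    (v : Fin n → TangentSpace 𝓘(ℝ, V) x) :
    DForm.wedge β a b (Nat.add_comm 1 n) x (Fin.cons e v) = β (a.toLin x e) (b x v) := by
  rw [DForm.wedge_one_apply, ← Equiv.sum_comp Equiv.Perm.decomposeFin.symm,
    Fintype.sum_prod_type, Finset.sum_eq_single 0]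
  -- the permutations fixing `0` all contribute the same term
  · have h : ∀ τ : Equiv.Perm (Fin n),
        Equiv.Perm.sign (Equiv.Perm.decomposeFin.symm ((0 : Fin (n + 1)), τ)) •
          β (a.toLin x ((Fin.cons e v : Fin (n + 1) → TangentSpace 𝓘(ℝ, V) x)
            (Equiv.Perm.decomposeFin.symm ((0 : Fin (n + 1)), τ) 0)))
            (b x fun j => (Fin.cons e v : Fin (n + 1) → TangentSpace 𝓘(ℝ, V) x)
              (Equiv.Perm.decomposeFin.symm ((0 : Fin (n + 1)), τ) j.succ)) =
          β (a.toLin x e) (b x v) := by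
      intro τ
      rw [Equiv.Perm.decomposeFin.symm_sign]
      simp only [Equiv.Perm.decomposeFin_symm_apply_zero, Equiv.Perm.decomposeFin_symm_apply_succ,
        Equiv.swap_self, Equiv.refl_apply, Fin.cons_zero, Fin.cons_succ, if_true, one_mul]
      have h1 : (b x fun j => v (τ j)) = Equiv.Perm.sign τ • b x v := (b x).map_perm v τ
      rw [h1]
      rcases Int.units_eq_one_or (Equiv.Perm.sign τ) with hs | hs <;> simp [hs]
    rw [Finset.sum_congr rfl fun τ _ => h τ, Finset.sum_const, Finset.card_univ, Fintype.card_perm,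
      Fintype.card_fin, ← Nat.cast_smul_eq_nsmul ℝ, smul_smul, inv_mul_cancel₀, one_smul]
    exact Nat.cast_ne_zero.2 (Nat.factorial_ne_zero n)
  -- for the other permutations `e` is an argument of `b`
  · intro p _ hp
    refine Finset.sum_eq_zero fun τ _ => ?_
    rw [hb, map_zero, smul_zero]
    obtain ⟨q, rfl⟩ := Fin.exists_succ_eq.2 hp
    refine ⟨τ.symm q, ?_⟩
    simp [Equiv.Perm.decomposeFin_symm_apply_succ]
  · simp

theorem DForm.wedge_one_apply_eq_zero (β : F →L[ℝ] F' →L[ℝ] F'') (a : DForm V X 1 F)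
    (b : DForm V X n F') (x : X) (v : Fin (n + 1) → TangentSpace 𝓘(ℝ, V) x)
    (hv : ∀ i, a.toLin x (v i) = 0) :
    DForm.wedge β a b (Nat.add_comm 1 n) x v = 0 := by
  simp [DForm.wedge_one_apply, hv]

end Wedge

/-! ### Exterior derivative of an equivariant form on a vector space -/

theorem minSmoothness_real_two_le_infty : minSmoothness ℝ 2 ≤ ∞ := by
  rw [minSmoothness_of_isRCLikeNormedField]
  exact WithTop.coe_le_coe.2 (le_top : (2 : ℕ∞) ≤ ⊤)

section Infinitesimal

variable {Z : Type*} [NormedAddCommGroup Z] [NormedSpace ℝ Z]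
  {V : Type*} [NormedAddCommGroup V] [NormedSpace ℝ V]
  {F : Type*} [NormedAddCommGroup F] [NormedSpace ℝ F] {n : ℕ}

/-- Cartan's formula for an equivariant horizontal form, in coordinates. Let `Ψ` be a family of
self-maps of `V`, the identity at the parameter `z₀`, under which the form `α` is equivariant in
the sense that `T(z) Ψ(z, ·)^* α = α`, and suppose that `α` is annihilated by the vector field
`ξ = ∂Ψ/∂z (z₀, ·) A`. Then `i_ξ dα = -(dT(z₀) A) α`. -/
theorem extDeriv_cons_of_equivariant (α : V → V [⋀^Fin n]→L[ℝ] F) (Ψ : Z × V → V)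
    (T : Z → F →L[ℝ] F) (z₀ : Z) (y₀ : V) (A : Z) (hα : DifferentiableAt ℝ α y₀)
    (hΨ : ContDiffAt ℝ ∞ Ψ (z₀, y₀)) (hΨ₀ : ∀ᶠ y in 𝓝 y₀, Ψ (z₀, y) = y)
    (hT : DifferentiableAt ℝ T z₀) (hT₀ : T z₀ = ContinuousLinearMap.id ℝ F)
    (hequiv : ∀ᶠ p in 𝓝 (z₀, y₀), ∀ v : Fin n → V,
      T p.1 (α (Ψ p) fun i => fderiv ℝ Ψ p (0, v i)) = α p.2 v)
    (hhor : ∀ᶠ y in 𝓝 y₀, ∀ v : Fin n → V, (∃ i, v i = fderiv ℝ Ψ (z₀, y) (A, 0)) → α y v = 0)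
    (v : Fin n → V) :
    extDeriv α y₀ (Fin.cons (fderiv ℝ Ψ (z₀, y₀) (A, 0)) v) = -(fderiv ℝ T z₀ A (α y₀ v)) := by
  have hΨy : Ψ (z₀, y₀) = y₀ := hΨ₀.self_of_nhds
  have hα' : DifferentiableAt ℝ α (Ψ (z₀, y₀)) := by rwa [hΨy]
  have hι : ∀ y, HasFDerivAt (fun y : V => ((z₀, y) : Z × V)) (ContinuousLinearMap.inr ℝ Z V) y :=
    fun y => hasFDerivAt_prodMk_right z₀ y
  have hΨd : DifferentiableAt ℝ Ψ (z₀, y₀) := hΨ.differentiableAt (by simp)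
  -- `Ψ(z₀, ·)` is the identity near `y₀`, so its derivative fixes the vectors tangent to `V`
  have hfix : ∀ᶠ y in 𝓝 y₀, ∀ w, fderiv ℝ Ψ (z₀, y) (0, w) = w := by
    have h1 : ∀ᶠ p in 𝓝 (z₀, y₀), DifferentiableAt ℝ Ψ p :=
      ((hΨ.of_le (m := 1) (by norm_cast)).eventually (by simp)).mono
        fun p hp => hp.differentiableAt (by simp)
    have h2 := (hι y₀).continuousAt.eventually h1
    filter_upwards [hΨ₀.eventually_nhds, h2] with y hy hd w
    have h3 : HasFDerivAt (fun y => Ψ (z₀, y))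
        ((fderiv ℝ Ψ (z₀, y)).comp (ContinuousLinearMap.inr ℝ Z V)) y :=
      HasFDerivAt.comp y hd.hasFDerivAt (hι y)
    have h4 := (h3.congr_of_eventuallyEq (hy.mono fun y hy => hy.symm)).unique (hasFDerivAt_id y)
    simpa using DFunLike.congr_fun h4 w
  set β : Z × V → (Z × V) [⋀^Fin n]→L[ℝ] F :=
    fun p => (α (Ψ p)).compContinuousLinearMap (fderiv ℝ Ψ p) with hβdef
  have hdΨ : DifferentiableAt ℝ (fderiv ℝ Ψ) (z₀, y₀) :=
    (hΨ.fderiv_right (m := 1) (by norm_cast)).differentiableAt (by simp)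
  have hβ : DifferentiableAt ℝ β (z₀, y₀) :=
    (hα'.comp _ hΨd).continuousAlternatingMapCompContinuousLinearMap hdΨ
  have hβv : ∀ w : Fin n → Z × V, DifferentiableAt ℝ (fun p => β p w) (z₀, y₀) := fun w =>
    ((ContinuousAlternatingMap.apply ℝ (Z × V) F w).differentiableAt).comp _ hβ
  let w : Fin (n + 1) → Z × V := Fin.cons (A, 0) fun i => (0, v i)
  have hpull := extDeriv_pullback (r := ∞) hα' hΨ minSmoothness_real_two_le_infty
  have hleft : extDeriv β (z₀, y₀) w =
      extDeriv α y₀ (Fin.cons (fderiv ℝ Ψ (z₀, y₀) (A, 0)) v) := by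
    rw [hβdef, hpull, ContinuousAlternatingMap.compContinuousLinearMap_apply, hΨy]
    congr 1
    ext i
    refine Fin.cases ?_ (fun i => ?_) i
    · simp [w]
    · simp [w, hfix.self_of_nhds]
  rw [← hleft, extDeriv_apply hβ, Fin.sum_univ_succ]
  -- the terms in which one of the `v i` is the direction of differentiation vanish
  have hzero : ∀ i : Fin n,
      fderiv ℝ (fun p => β p (i.succ.removeNth w)) (z₀, y₀) (w i.succ) = 0 := by
    intro i
    obtain _ | n := n
    · exact i.elim0
    have h1 : HasFDerivAt (fun y => β (z₀, y) (i.succ.removeNth w))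
        ((fderiv ℝ (fun p => β p (i.succ.removeNth w)) (z₀, y₀)).comp
          (ContinuousLinearMap.inr ℝ Z V)) y₀ :=
      HasFDerivAt.comp y₀ (f := fun y : V => ((z₀, y) : Z × V))
        (hβv (i.succ.removeNth w)).hasFDerivAt (hι y₀)
    have h2 : (fun y => β (z₀, y) (i.succ.removeNth w)) =ᶠ[𝓝 y₀] fun _ => 0 := by
      filter_upwards [hhor, hΨ₀] with y hy hy0
      rw [hβdef]
      simp only [ContinuousAlternatingMap.compContinuousLinearMap_apply, hy0]
      refine hy _ ⟨0, ?_⟩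
      simp [Fin.removeNth, w]
    have h3 := h1.unique ((hasFDerivAt_const (0 : F) y₀).congr_of_eventuallyEq h2)
    simpa [w] using DFunLike.congr_fun h3 (v i)
  simp only [hzero, smul_zero, Finset.sum_const_zero, add_zero, Fin.val_zero, pow_zero, one_smul]
  have hw0 : (0 : Fin (n + 1)).removeNth w = fun i => ((0, v i) : Z × V) := by
    ext1 i; simp [Fin.removeNth, w]
  rw [hw0, show w 0 = (A, 0) from rfl]
  -- the remaining term comes from differentiating `T(z) Ψ(z, ·)^* α = α` at `z₀`
  have hfst : HasFDerivAt (fun p : Z × V => T p.1)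
      ((fderiv ℝ T z₀).comp (ContinuousLinearMap.fst ℝ Z V)) (z₀, y₀) :=
    HasFDerivAt.comp (g := T) (z₀, y₀) hT.hasFDerivAt hasFDerivAt_fst
  have h1 := hfst.clm_apply (hβv fun i => (0, v i)).hasFDerivAt
  have h2 : HasFDerivAt (fun p : Z × V => α p.2 v)
      (((ContinuousAlternatingMap.apply ℝ V F v).comp (fderiv ℝ α y₀)).comp
        (ContinuousLinearMap.snd ℝ Z V)) (z₀, y₀) :=
    HasFDerivAt.comp (g := fun y => α y v) (z₀, y₀)
      ((ContinuousAlternatingMap.apply ℝ V F v).hasFDerivAt.comp y₀ hα.hasFDerivAt) hasFDerivAt_snd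
  have h3 : (fun p : Z × V => α p.2 v) =ᶠ[𝓝 (z₀, y₀)]
      fun p => T p.1 (β p fun i => (0, v i)) := by
    filter_upwards [hequiv] with p hp
    exact (hp v).symm
  have h4 := DFunLike.congr_fun ((h1.congr_of_eventuallyEq h3).unique h2) (A, 0)
  have h5 : β (z₀, y₀) (fun i => (0, v i)) = α y₀ v := by
    rw [hβdef]
    simp only [ContinuousAlternatingMap.compContinuousLinearMap_apply, hΨy, Function.comp_def,
      hfix.self_of_nhds]
  simp only [hT₀, h5, add_apply, ContinuousLinearMap.comp_apply,
    ContinuousLinearMap.id_apply, ContinuousLinearMap.flip_apply, ContinuousLinearMap.coe_fst',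
    ContinuousLinearMap.coe_snd', map_zero] at h4
  exact eq_neg_of_add_eq_zero_left h4

end Infinitesimal

/-! ### Naturality of the exterior derivative -/

namespace DForm

variable {V : Type*} [NormedAddCommGroup V] [NormedSpace ℝ V]
  {V' : Type*} [NormedAddCommGroup V'] [NormedSpace ℝ V']
  {V'' : Type*} [NormedAddCommGroup V''] [NormedSpace ℝ V'']
  {F : Type*} [NormedAddCommGroup F] [NormedSpace ℝ F]
  {F' : Type*} [NormedAddCommGroup F'] [NormedSpace ℝ F']
  {X : Type*} [TopologicalSpace X] [ChartedSpace V X]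
  {Y : Type*} [TopologicalSpace Y] [ChartedSpace V' Y]
  {Y' : Type*} [TopologicalSpace Y'] [ChartedSpace V'' Y'] {n : ℕ}

/-- Tangent spaces at equal points are compared through their common underlying space `V`. -/
theorem apply_congr (a : DForm V X n F) {x x' : X} (h : x = x')
    {v : Fin n → TangentSpace 𝓘(ℝ, V) x} {v' : Fin n → TangentSpace 𝓘(ℝ, V) x'}
    (hv : ∀ i, (v i : V) = v' i) : a x v = a x' v' := by
  subst h
  rw [show v = v' from funext hv]

theorem pullback_apply (f : X → Y) (a : DForm V' Y n F) (x : X)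
    (v : Fin n → TangentSpace 𝓘(ℝ, V) x) :
    pullback (V := V) f a x v = a (f x) fun i => mfderiv 𝓘(ℝ, V) 𝓘(ℝ, V') f x (v i) := rfl

theorem chartRep_eq_pullback (a : DForm V X n F) (x₀ : X) :
    a.chartRep x₀ = pullback (V := V) (X := V) (extChartAt 𝓘(ℝ, V) x₀).symm a := rfl

theorem pullback_comp (g : Y → Y') (f : X → Y) (a : DForm V'' Y' n F) (x : X)
    (hg : MDifferentiableAt 𝓘(ℝ, V') 𝓘(ℝ, V'') g (f x))
    (hf : MDifferentiableAt 𝓘(ℝ, V) 𝓘(ℝ, V') f x) :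
    pullback (V := V) (g ∘ f) a x = pullback (V := V) f (pullback (V := V') g a) x := by
  ext v
  simp only [pullback_apply, mfderiv_comp x hg hf]
  rfl

theorem pullback_congr {f g : X → Y} (a : DForm V' Y n F) {x : X} (h : f =ᶠ[𝓝 x] g) :
    pullback (V := V) f a x = pullback (V := V) g a x := by
  ext v
  refine apply_congr a h.self_of_nhds fun i => ?_
  exact DFunLike.congr_fun h.mfderiv_eq (v i)

theorem pullback_vectorSpace (f : V → V') (a : V' → V' [⋀^Fin n]→L[ℝ] F) (x : V) :
    pullback (X := V) (Y := V') f a x = (a (f x)).compContinuousLinearMap (fderiv ℝ f x) := by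
  rw [← mfderiv_eq_fderiv]
  rfl

end DForm

section Charts

variable {V : Type*} [NormedAddCommGroup V] [NormedSpace ℝ V]
  {X : Type*} [TopologicalSpace X] [ChartedSpace V X] [IsManifold 𝓘(ℝ, V) ∞ X]

theorem contMDiffAt_extChartAt_symm (x : X) {y : V} (hy : y ∈ (extChartAt 𝓘(ℝ, V) x).target) :
    ContMDiffAt 𝓘(ℝ, V) 𝓘(ℝ, V) ∞ (extChartAt 𝓘(ℝ, V) x).symm y :=
  (contMDiffOn_extChartAt_symm x).contMDiffAt ((isOpen_extChartAt_target x).mem_nhds hy)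

theorem contMDiffAt_extChartAt_of_mem_source (x : X) {x' : X}
    (hx' : x' ∈ (extChartAt 𝓘(ℝ, V) x).source) :
    ContMDiffAt 𝓘(ℝ, V) 𝓘(ℝ, V) ∞ (extChartAt 𝓘(ℝ, V) x) x' :=
  contMDiffAt_extChartAt' (by rwa [extChartAt_source] at hx')

theorem mfderiv_extChartAt_symm_comp_apply (x : X) {y : V}
    (hy : y ∈ (extChartAt 𝓘(ℝ, V) x).target)
    (v : TangentSpace 𝓘(ℝ, V) ((extChartAt 𝓘(ℝ, V) x).symm y)) :
    mfderiv 𝓘(ℝ, V) 𝓘(ℝ, V) (extChartAt 𝓘(ℝ, V) x).symm y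
      (mfderiv 𝓘(ℝ, V) 𝓘(ℝ, V) (extChartAt 𝓘(ℝ, V) x) ((extChartAt 𝓘(ℝ, V) x).symm y) v) = v := by
  have : IsManifold 𝓘(ℝ, V) 1 X := IsManifold.of_le (n := ∞) (by norm_cast)
  have h := mfderivWithin_extChartAt_symm_comp_mfderiv_extChartAt (I := 𝓘(ℝ, V)) hy
  rw [modelWithCornersSelf_coe, Set.range_id, mfderivWithin_univ] at h
  exact DFunLike.congr_fun h v

theorem mfderiv_extChartAt_self_apply (x : X) (v : TangentSpace 𝓘(ℝ, V) x) :
    mfderiv 𝓘(ℝ, V) 𝓘(ℝ, V) (extChartAt 𝓘(ℝ, V) x) x v = v := by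
  have : IsManifold 𝓘(ℝ, V) 1 X := IsManifold.of_le (n := ∞) (by norm_cast)
  rw [mfderiv_extChartAt_self]
  rfl

theorem mfderiv_extChartAt_symm_self_apply (x : X) (v : V) :
    mfderiv 𝓘(ℝ, V) 𝓘(ℝ, V) (extChartAt 𝓘(ℝ, V) x).symm (extChartAt 𝓘(ℝ, V) x x) v = v := by
  have : IsManifold 𝓘(ℝ, V) 1 X := IsManifold.of_le (n := ∞) (by norm_cast)
  have h := mfderivWithin_range_extChartAt_symm (I := 𝓘(ℝ, V)) (x := x)
  rw [modelWithCornersSelf_coe, Set.range_id, mfderivWithin_univ] at h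
  rw [h]
  rfl

end Charts

namespace DForm

variable {V : Type*} [NormedAddCommGroup V] [NormedSpace ℝ V]
  {V' : Type*} [NormedAddCommGroup V'] [NormedSpace ℝ V']
  {F : Type*} [NormedAddCommGroup F] [NormedSpace ℝ F]
  {F' : Type*} [NormedAddCommGroup F'] [NormedSpace ℝ F']
  {X : Type*} [TopologicalSpace X] [ChartedSpace V X] [IsManifold 𝓘(ℝ, V) ∞ X]
  {Y : Type*} [TopologicalSpace Y] [ChartedSpace V' Y] [IsManifold 𝓘(ℝ, V') ∞ Y] {n : ℕ}

/-- The derivative of the preferred chart around `x` is the identity at `x`, so that it drops out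
of the definition of the exterior derivative. -/
theorem d_apply (a : DForm V X n F) (x : X) (v : Fin (n + 1) → TangentSpace 𝓘(ℝ, V) x) :
    a.d x v = extDeriv (a.chartRep x) (extChartAt 𝓘(ℝ, V) x x) v := by
  change extDeriv (a.chartRep x) (extChartAt 𝓘(ℝ, V) x x) (fun i =>
    mfderiv 𝓘(ℝ, V) 𝓘(ℝ, V) (extChartAt 𝓘(ℝ, V) x) x (v i)) = _
  congr 1
  ext i
  exact mfderiv_extChartAt_self_apply x (v i)

theorem chartRep_self_apply (a : DForm V X n F) (x : X) (v : Fin n → TangentSpace 𝓘(ℝ, V) x) :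
    a.chartRep x (extChartAt 𝓘(ℝ, V) x x) v = a x v :=
  apply_congr a (v := fun i => mfderiv 𝓘(ℝ, V) 𝓘(ℝ, V) (extChartAt 𝓘(ℝ, V) x).symm
    (extChartAt 𝓘(ℝ, V) x x) (v i : V)) (extChartAt_to_inv x)
    fun i => mfderiv_extChartAt_symm_self_apply (V := V) x (v i)

omit [IsManifold 𝓘(ℝ, V) ∞ X] in
theorem IsSmooth.differentiableAt_chartRep {a : DForm V X n F} (ha : a.IsSmooth) (x : X) :
    DifferentiableAt ℝ (a.chartRep x) (extChartAt 𝓘(ℝ, V) x x) :=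
  ((ha x).contDiffAt (extChartAt_target_mem_nhds x)).differentiableAt (by simp)

/-- The exterior derivative commutes with pull-backs. -/
theorem d_pullback {f : X → Y} (hf : ContMDiff 𝓘(ℝ, V) 𝓘(ℝ, V') ∞ f) {a : DForm V' Y n F}
    (ha : a.IsSmooth) : (pullback (V := V) f a).d = pullback (V := V) f a.d := by
  funext x
  ext v
  set φ := extChartAt 𝓘(ℝ, V) x with hφ
  set φ' := extChartAt 𝓘(ℝ, V') (f x) with hφ'
  set ψ : V → V' := φ' ∘ f ∘ φ.symm with hψ
  have hψx : ψ (φ x) = φ' (f x) := by simp [hψ, hφ]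
  have hψs : ContDiffAt ℝ ∞ ψ (φ x) := by
    rw [← contMDiffAt_iff_contDiffAt]
    refine ContMDiffAt.comp _ ?_ (ContMDiffAt.comp _ (hf _)
      (contMDiffAt_extChartAt_symm x (mem_extChartAt_target x)))
    refine contMDiffAt_extChartAt_of_mem_source _ ?_
    simp [hφ]
  have hder : ∀ w : V, fderiv ℝ ψ (φ x) w = mfderiv 𝓘(ℝ, V) 𝓘(ℝ, V') f x w := by
    have h := fderivWithin_univ (𝕜 := ℝ) (f := ψ)
    rw [← Set.range_id, ← modelWithCornersSelf_coe ℝ V] at h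
    have hm : MDifferentiableAt 𝓘(ℝ, V) 𝓘(ℝ, V') f x := (hf x).mdifferentiableAt (by simp)
    rw [← h]
    exact fun w => (DFunLike.congr_fun hm.mfderiv w).symm
  -- in the charts, pulling back along `f` is pulling back along its coordinate expression `ψ`
  have hrep : (pullback (V := V) f a).chartRep x =ᶠ[𝓝 (φ x)]
      fun y => (a.chartRep (f x) (ψ y)).compContinuousLinearMap (fderiv ℝ ψ y) := by
    have hsrc : ∀ᶠ y in 𝓝 (φ x), f (φ.symm y) ∈ φ'.source := by
      have hc : ContinuousAt (f ∘ φ.symm) (φ x) :=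
        hf.continuous.continuousAt.comp (continuousAt_extChartAt_symm x)
      refine hc.eventually_mem ((isOpen_extChartAt_source _).mem_nhds ?_)
      simp [hφ]
    filter_upwards [hsrc.eventually_nhds, extChartAt_target_mem_nhds x,
      ((hψs.of_le (m := 1) (by norm_cast)).eventually (by simp))] with y hy hyt hyd
    have hfd : MDifferentiableAt 𝓘(ℝ, V) 𝓘(ℝ, V) φ.symm y :=
      (contMDiffAt_extChartAt_symm x hyt).mdifferentiableAt (by simp)
    have hψd : MDifferentiableAt 𝓘(ℝ, V) 𝓘(ℝ, V') ψ y :=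
      (hyd.differentiableAt (by simp)).mdifferentiableAt
    have hφd : MDifferentiableAt 𝓘(ℝ, V') 𝓘(ℝ, V') φ'.symm (ψ y) :=
      (contMDiffAt_extChartAt_symm _ (φ'.map_source hy.self_of_nhds)).mdifferentiableAt (by simp)
    have hcomp : f ∘ φ.symm =ᶠ[𝓝 y] φ'.symm ∘ ψ :=
      hy.mono fun z hz => (φ'.left_inv hz).symm
    rw [chartRep_eq_pullback, ← pullback_comp _ _ _ _ ((hf _).mdifferentiableAt (by simp)) hfd,
      pullback_congr a hcomp, pullback_comp _ _ _ _ hφd hψd]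
    exact pullback_vectorSpace ψ _ y
  have hdiff : DifferentiableAt ℝ (a.chartRep (f x)) (ψ (φ x)) := by
    rw [hψx]
    exact ha.differentiableAt_chartRep (f x)
  have hleft : extDeriv ((pullback (V := V) f a).chartRep x) (φ x) =
      (extDeriv (a.chartRep (f x)) (φ' (f x))).compContinuousLinearMap (fderiv ℝ ψ (φ x)) := by
    rw [hrep.extDeriv_eq, extDeriv_pullback hdiff hψs (r := ∞) minSmoothness_real_two_le_infty, hψx]
  refine (d_apply _ x v).trans ((DFunLike.congr_fun hleft v).trans ?_)
  refine Eq.trans ?_ (d_apply a (f x) fun i => mfderiv 𝓘(ℝ, V) 𝓘(ℝ, V') f x (v i)).symm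
  exact congrArg (extDeriv (a.chartRep (f x)) (φ' (f x))) (funext fun i => hder (v i))

/-- The exterior derivative commutes with linear maps of the coefficients. -/
theorem d_map (L : F →L[ℝ] F') {a : DForm V X n F} (ha : a.IsSmooth) :
    (a.map L).d = a.d.map L := by
  funext x
  ext v
  have hd := ha.differentiableAt_chartRep x
  have hrep : (a.map L).chartRep x =
      fun y => ContinuousLinearMap.compContinuousAlternatingMapCLM ℝ V F F' (Fin n) L
        (a.chartRep x y) := rfl
  have hd' : DifferentiableAt ℝ ((a.map L).chartRep x) (extChartAt 𝓘(ℝ, V) x x) := by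
    rw [hrep]
    exact (ContinuousLinearMap.differentiableAt _).comp _ hd
  have key : ∀ v : Fin (n + 1) → V,
      extDeriv ((a.map L).chartRep x) (extChartAt 𝓘(ℝ, V) x x) v =
        L (extDeriv (a.chartRep x) (extChartAt 𝓘(ℝ, V) x x) v) := by
    intro v
    rw [extDeriv_apply hd, extDeriv_apply hd', map_sum]
    refine Finset.sum_congr rfl fun i _ => ?_
    rw [map_zsmul]
    congr 1
    have h : DifferentiableAt ℝ (fun y => a.chartRep x y (i.removeNth v))
        (extChartAt 𝓘(ℝ, V) x x) :=
      ((ContinuousAlternatingMap.apply ℝ V F (i.removeNth v)).differentiableAt).comp _ hd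
    exact DFunLike.congr_fun (L.hasFDerivAt.comp _ h.hasFDerivAt).fderiv (v i)
  exact (d_apply _ x v).trans ((key v).trans (congrArg L (d_apply a x v)).symm)

end DForm

/-! ### The action of a Lie group on the Lie algebra of a crossed module -/

namespace LieCrossedModule

variable {VG : Type*} [NormedAddCommGroup VG] [NormedSpace ℝ VG]
  {G : Type*} [TopologicalSpace G] [ChartedSpace VG G] [Group G]
  {VE : Type*} [NormedAddCommGroup VE] [NormedSpace ℝ VE]
  {E : Type*} [TopologicalSpace E] [ChartedSpace VE E] [Group E]
  (C : LieCrossedModule VG G VE E)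

theorem contMDiff_act_left (g : G) : ContMDiff 𝓘(ℝ, VE) 𝓘(ℝ, VE) ∞ fun e : E => C.act g e :=
  C.contMDiff_act.comp (contMDiff_const.prodMk contMDiff_id)

theorem groupAct_one : C.groupAct 1 = ContinuousLinearMap.id ℝ (LieAlg VE E) := by
  have h : (fun e : E => C.act 1 e) = id := by ext e; simp
  rw [groupAct, h]
  exact mfderiv_id

theorem groupAct_mul_apply (g h : G) (x : LieAlg VE E) :
    C.groupAct (g * h) x = C.groupAct g (C.groupAct h x) := by
  have hgh : (fun e : E => C.act (g * h) e) = (fun e => C.act g e) ∘ fun e => C.act h e := by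
    ext e; simp
  have h1 : MDifferentiableAt 𝓘(ℝ, VE) 𝓘(ℝ, VE) (fun e => C.act h e) (1 : E) :=
    (C.contMDiff_act_left h _).mdifferentiableAt (by simp)
  have h2 : MDifferentiableAt 𝓘(ℝ, VE) 𝓘(ℝ, VE) (fun e => C.act g e) (C.act h (1 : E)) :=
    (C.contMDiff_act_left g _).mdifferentiableAt (by simp)
  have h3 := mfderiv_comp (1 : E) h2 h1
  rw [← hgh, map_one] at h3
  exact DFunLike.congr_fun h3 x

variable [IsManifold 𝓘(ℝ, VG) ∞ G] [IsManifold 𝓘(ℝ, VE) ∞ E]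

theorem contMDiff_groupAct :
    ContMDiff 𝓘(ℝ, VG) 𝓘(ℝ, LieAlg VE E →L[ℝ] LieAlg VE E) ∞ C.groupAct := by
  have : IsManifold 𝓘(ℝ, VE) 1 E := IsManifold.of_le (n := ∞) (by norm_cast)
  intro g₀
  have h := ContMDiffAt.mfderiv (I := 𝓘(ℝ, VE)) (I' := 𝓘(ℝ, VE)) (x₀ := g₀) (m := ∞) (n := ∞)
    (fun (g : G) (e : E) => C.act g e) (fun _ => (1 : E)) (C.contMDiff_act _) contMDiffAt_const
    (by norm_cast)
  -- all the points `g ▷ 1` are equal to `1`, so the changes of coordinates are trivial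
  convert! h using 1
  funext g
  have hcoord := inTangentCoordinates_eq (I := 𝓘(ℝ, VE)) (I' := 𝓘(ℝ, VE)) (x₀ := g₀) (x := g)
    (fun _ : G => (1 : E)) (fun g => C.act g (1 : E)) C.groupAct (mem_chart_source _ _) (by simp)
  refine Eq.trans ?_ hcoord.symm
  ext x
  have hc : ∀ (e e' e₁ : E) (v : VE), e = 1 → e' = 1 → e₁ = 1 →
      (tangentBundleCore 𝓘(ℝ, VE) E).coordChange (achart VE e) (achart VE e') e₁ v = v := by
    rintro _ _ _ v rfl rfl rfl
    exact (tangentBundleCore 𝓘(ℝ, VE) E).coordChange_self _ _ (mem_chart_source VE (1 : E)) v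
  refine Eq.trans ?_ (hc _ _ _ _ (map_one (C.act g)) (map_one (C.act g₀))
    (map_one (C.act g))).symm
  exact (congrArg (C.groupAct g) (hc 1 1 1 x rfl rfl rfl)).symm

/-- The derived action is the derivative of `groupAct` in the preferred chart around `1`; this uses
that `groupAct` is differentiable, as otherwise `lieAct` would be the junk value `0`. -/
theorem fderiv_groupAct_extChartAt_symm :
    fderiv ℝ (fun z => C.groupAct ((extChartAt 𝓘(ℝ, VG) (1 : G)).symm z))
      (extChartAt 𝓘(ℝ, VG) (1 : G) 1) = C.lieAct := by
  have hm := (C.contMDiff_groupAct 1).mdifferentiableAt (n := ∞) (by simp)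
  have h := hm.mfderiv
  rw [modelWithCornersSelf_coe, Set.range_id, fderivWithin_univ] at h
  exact h.symm

end LieCrossedModule

/-! ### Fundamental vector fields and the horizontal projection -/

namespace SmoothPrincipalBundle

variable {VG : Type*} [NormedAddCommGroup VG] [NormedSpace ℝ VG]
  {G : Type*} [TopologicalSpace G] [ChartedSpace VG G] [Group G]
  {VM : Type*} [NormedAddCommGroup VM] [NormedSpace ℝ VM]
  {M : Type*} [TopologicalSpace M] [ChartedSpace VM M]
  {VP : Type*} [NormedAddCommGroup VP] [NormedSpace ℝ VP]
  {P : Type*} [TopologicalSpace P] [ChartedSpace VP P]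
  {F : Type*} [NormedAddCommGroup F] [NormedSpace ℝ F]
  (B : SmoothPrincipalBundle VG G VM M VP P) {n : ℕ}

theorem contMDiff_R_left (g : G) : ContMDiff 𝓘(ℝ, VP) 𝓘(ℝ, VP) ∞ (B.R g) :=
  B.contMDiff_R.comp (contMDiff_id.prodMk contMDiff_const)

theorem contMDiff_R_right (u : P) : ContMDiff 𝓘(ℝ, VG) 𝓘(ℝ, VP) ∞ fun g => B.R g u :=
  B.contMDiff_R.comp (contMDiff_const.prodMk contMDiff_id)

theorem horProj_apply (θ : DForm VP P 1 (LieAlg VG G)) (u : P) (v : TangentSpace 𝓘(ℝ, VP) u) :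
    B.horProj θ u v = v - B.fund u (θ.toLin u v) := rfl

variable {θ : DForm VP P 1 (LieAlg VG G)}

theorem toLin_fund (hθ : B.IsConnection θ) (u : P) (A : LieAlg VG G) :
    θ.toLin u (B.fund u A) = A := by
  rw [DForm.toLin_apply]
  exact hθ.apply_fund u A

theorem horProj_fund (hθ : B.IsConnection θ) (u : P) (A : LieAlg VG G) :
    B.horProj θ u (B.fund u A) = 0 := by
  rw [horProj_apply, B.toLin_fund hθ, sub_self]

theorem IsHorizontal.apply_eq_zero {a : DForm VP P n F} (ha : B.IsHorizontal θ a)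
    (hθ : B.IsConnection θ) (u : P) (A : LieAlg VG G) (v : Fin n → TangentSpace 𝓘(ℝ, VP) u)
    (hv : ∃ i, v i = B.fund u A) : a u v = 0 := by
  obtain ⟨i, hi⟩ := hv
  rw [congrFun ha u]
  refine (a u).map_coord_zero i ?_
  exact (congrArg (B.horProj θ u) hi).trans (B.horProj_fund hθ u A)

variable [LieGroup 𝓘(ℝ, VG) ∞ G]

/-- `R_g` carries the fundamental vector field of `A` to that of `g⁻¹ A g`. -/
theorem mfderiv_R_fund (g : G) (u : P) (A : LieAlg VG G) :
    mfderiv 𝓘(ℝ, VP) 𝓘(ℝ, VP) (B.R g) u (B.fund u A) =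
      B.fund (B.R g u) (adjointAction VG g⁻¹ A) := by
  have hconj : ContMDiff 𝓘(ℝ, VG) 𝓘(ℝ, VG) ∞ fun h : G => g⁻¹ * h * g⁻¹⁻¹ :=
    (contMDiff_const.mul contMDiff_id).mul contMDiff_const
  have h1 := mfderiv_comp (1 : G) ((B.contMDiff_R_left g (B.R 1 u)).mdifferentiableAt (by simp))
    ((B.contMDiff_R_right u 1).mdifferentiableAt (by simp))
  have h2 := mfderiv_comp (1 : G)
    ((B.contMDiff_R_right (B.R g u) (g⁻¹ * 1 * g⁻¹⁻¹)).mdifferentiableAt (by simp))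
    ((hconj 1).mdifferentiableAt (by simp))
  have h3 : (fun h => B.R h (B.R g u)) ∘ (fun h : G => g⁻¹ * h * g⁻¹⁻¹) =
      B.R g ∘ fun h => B.R h u := by
    funext h
    simp only [Function.comp_apply, ← B.R_mul]
    congr 1
    group
  rw [h3, h1] at h2
  rw [B.R_one, mul_one, mul_inv_cancel] at h2
  exact DFunLike.congr_fun h2 A

/-- The horizontal projection commutes with the right action. -/
theorem mfderiv_R_horProj (hθ : B.IsConnection θ) (g : G) (u : P) (v : TangentSpace 𝓘(ℝ, VP) u) :
    mfderiv 𝓘(ℝ, VP) 𝓘(ℝ, VP) (B.R g) u (B.horProj θ u v) =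
      B.horProj θ (B.R g u) (mfderiv 𝓘(ℝ, VP) 𝓘(ℝ, VP) (B.R g) u v) := by
  have h : θ.toLin (B.R g u) (mfderiv 𝓘(ℝ, VP) 𝓘(ℝ, VP) (B.R g) u v) =
      adjointAction VG g⁻¹ (θ.toLin u v) := by
    have h1 := DFunLike.congr_fun (congrFun (hθ.equivariant g) u) ![v]
    rw [DForm.toLin_apply, DForm.toLin_apply]
    refine Eq.trans ?_ h1
    refine congrArg (θ (B.R g u)) ?_
    ext i
    fin_cases i
    rfl
  rw [horProj_apply, horProj_apply, map_sub, B.mfderiv_R_fund, h]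

end SmoothPrincipalBundle

/-! ### Cartan's formula and the structure equation -/

namespace SmoothPrincipalBundle

variable {VG : Type*} [NormedAddCommGroup VG] [NormedSpace ℝ VG]
  {G : Type*} [TopologicalSpace G] [ChartedSpace VG G] [Group G] [LieGroup 𝓘(ℝ, VG) ∞ G]
  {VE : Type*} [NormedAddCommGroup VE] [NormedSpace ℝ VE]
  {E : Type*} [TopologicalSpace E] [ChartedSpace VE E] [Group E]
  {VM : Type*} [NormedAddCommGroup VM] [NormedSpace ℝ VM]
  {M : Type*} [TopologicalSpace M] [ChartedSpace VM M]
  {VP : Type*} [NormedAddCommGroup VP] [NormedSpace ℝ VP]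
  {P : Type*} [TopologicalSpace P] [ChartedSpace VP P] [IsManifold 𝓘(ℝ, VP) ∞ P]
  {F : Type*} [NormedAddCommGroup F] [NormedSpace ℝ F]
  (B : SmoothPrincipalBundle VG G VM M VP P) {n : ℕ}

/-- The right action near `(1, u)`, read in the preferred charts around `1` and `u`. It is
meaningful only where both coordinates lie in the targets of the charts and the translated point
lies in the source of the chart around `u`. -/
noncomputable def actionInChart (u : P) (p : VG × VP) : VP :=
  extChartAt 𝓘(ℝ, VP) u (B.R ((extChartAt 𝓘(ℝ, VG) (1 : G)).symm p.1)
    ((extChartAt 𝓘(ℝ, VP) u).symm p.2))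

omit [LieGroup 𝓘(ℝ, VG) ∞ G] [IsManifold 𝓘(ℝ, VP) ∞ P] in
theorem actionInChart_base {u : P} {y : VP} (hy : y ∈ (extChartAt 𝓘(ℝ, VP) u).target) :
    B.actionInChart u (extChartAt 𝓘(ℝ, VG) (1 : G) 1, y) = y := by
  rw [actionInChart, extChartAt_to_inv, B.R_one, (extChartAt 𝓘(ℝ, VP) u).right_inv hy]

theorem contDiffAt_actionInChart {u : P} {p : VG × VP}
    (h1 : p.1 ∈ (extChartAt 𝓘(ℝ, VG) (1 : G)).target) (h2 : p.2 ∈ (extChartAt 𝓘(ℝ, VP) u).target)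
    (h3 : B.R ((extChartAt 𝓘(ℝ, VG) (1 : G)).symm p.1) ((extChartAt 𝓘(ℝ, VP) u).symm p.2) ∈
      (extChartAt 𝓘(ℝ, VP) u).source) :
    ContDiffAt ℝ ∞ (B.actionInChart u) p := by
  rw [← contMDiffAt_iff_contDiffAt]
  have hg : ContMDiffAt 𝓘(ℝ, VG × VP) 𝓘(ℝ, VG) ∞
      (fun p : VG × VP => (extChartAt 𝓘(ℝ, VG) (1 : G)).symm p.1) p :=
    ContMDiffAt.comp p (contMDiffAt_extChartAt_symm _ h1) contDiffAt_fst.contMDiffAt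
  have hu : ContMDiffAt 𝓘(ℝ, VG × VP) 𝓘(ℝ, VP) ∞
      (fun p : VG × VP => (extChartAt 𝓘(ℝ, VP) u).symm p.2) p :=
    ContMDiffAt.comp p (contMDiffAt_extChartAt_symm _ h2) contDiffAt_snd.contMDiffAt
  exact ContMDiffAt.comp p (contMDiffAt_extChartAt_of_mem_source u h3)
    ((B.contMDiff_R _).comp p (hu.prodMk hg))

omit [LieGroup 𝓘(ℝ, VG) ∞ G] [IsManifold 𝓘(ℝ, VP) ∞ P] in
theorem eventually_mem_actionInChart_domain (u : P) :
    ∀ᶠ p : VG × VP in 𝓝 (extChartAt 𝓘(ℝ, VG) (1 : G) 1, extChartAt 𝓘(ℝ, VP) u u),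
      p.1 ∈ (extChartAt 𝓘(ℝ, VG) (1 : G)).target ∧ p.2 ∈ (extChartAt 𝓘(ℝ, VP) u).target ∧
      B.R ((extChartAt 𝓘(ℝ, VG) (1 : G)).symm p.1) ((extChartAt 𝓘(ℝ, VP) u).symm p.2) ∈
        (extChartAt 𝓘(ℝ, VP) u).source := by
  have h1 : ∀ᶠ p : VG × VP in 𝓝 (extChartAt 𝓘(ℝ, VG) (1 : G) 1, extChartAt 𝓘(ℝ, VP) u u),
      p.1 ∈ (extChartAt 𝓘(ℝ, VG) (1 : G)).target :=
    continuousAt_fst.eventually_mem (extChartAt_target_mem_nhds (I := 𝓘(ℝ, VG)) (1 : G))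
  have h2 : ∀ᶠ p : VG × VP in 𝓝 (extChartAt 𝓘(ℝ, VG) (1 : G) 1, extChartAt 𝓘(ℝ, VP) u u),
      p.2 ∈ (extChartAt 𝓘(ℝ, VP) u).target :=
    continuousAt_snd.eventually_mem (extChartAt_target_mem_nhds (I := 𝓘(ℝ, VP)) u)
  have hg : ContinuousAt (fun p : VG × VP => (extChartAt 𝓘(ℝ, VG) (1 : G)).symm p.1)
      (extChartAt 𝓘(ℝ, VG) (1 : G) 1, extChartAt 𝓘(ℝ, VP) u u) :=
    ContinuousAt.comp (continuousAt_extChartAt_symm (1 : G)) continuousAt_fst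
  have hu : ContinuousAt (fun p : VG × VP => (extChartAt 𝓘(ℝ, VP) u).symm p.2)
      (extChartAt 𝓘(ℝ, VG) (1 : G) 1, extChartAt 𝓘(ℝ, VP) u u) :=
    ContinuousAt.comp (continuousAt_extChartAt_symm u) continuousAt_snd
  have hR : ContinuousAt (fun p : VG × VP => B.R ((extChartAt 𝓘(ℝ, VG) (1 : G)).symm p.1)
      ((extChartAt 𝓘(ℝ, VP) u).symm p.2))
      (extChartAt 𝓘(ℝ, VG) (1 : G) 1, extChartAt 𝓘(ℝ, VP) u u) :=
    B.contMDiff_R.continuous.continuousAt.comp (hu.prodMk hg)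
  refine h1.and (h2.and (hR.eventually_mem ((isOpen_extChartAt_source u).mem_nhds ?_)))
  simp [B.R_one]

/-- In the charts, the velocity at `z = χ(1)` of the action in the direction `A` is the fundamental
vector field of `A`. -/
theorem fderiv_actionInChart_inl {u : P} {y : VP} (hy : y ∈ (extChartAt 𝓘(ℝ, VP) u).target)
    (A : VG) :
    fderiv ℝ (B.actionInChart u) (extChartAt 𝓘(ℝ, VG) (1 : G) 1, y) (A, 0) =
      mfderiv 𝓘(ℝ, VP) 𝓘(ℝ, VP) (extChartAt 𝓘(ℝ, VP) u) ((extChartAt 𝓘(ℝ, VP) u).symm y)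
        (B.fund ((extChartAt 𝓘(ℝ, VP) u).symm y) A) := by
  set u' := (extChartAt 𝓘(ℝ, VP) u).symm y with hu'
  have hsrc : u' ∈ (extChartAt 𝓘(ℝ, VP) u).source := (extChartAt 𝓘(ℝ, VP) u).map_target hy
  have hd : DifferentiableAt ℝ (B.actionInChart u) (extChartAt 𝓘(ℝ, VG) (1 : G) 1, y) := by
    refine (B.contDiffAt_actionInChart (mem_extChartAt_target (1 : G)) hy ?_).differentiableAt
      (by simp)
    rwa [extChartAt_to_inv, B.R_one]
  have h1 : HasFDerivAt (fun z => B.actionInChart u (z, y))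
      ((fderiv ℝ (B.actionInChart u) (extChartAt 𝓘(ℝ, VG) (1 : G) 1, y)).comp
        (ContinuousLinearMap.inl ℝ VG VP)) (extChartAt 𝓘(ℝ, VG) (1 : G) 1) :=
    HasFDerivAt.comp (f := fun z => (z, y)) _ hd.hasFDerivAt (hasFDerivAt_prodMk_left _ _)
  have hχ : MDifferentiableAt 𝓘(ℝ, VG) 𝓘(ℝ, VG) (extChartAt 𝓘(ℝ, VG) (1 : G)).symm
      (extChartAt 𝓘(ℝ, VG) (1 : G) 1) :=
    (contMDiffAt_extChartAt_symm _ (mem_extChartAt_target _)).mdifferentiableAt (by simp)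
  have hR : MDifferentiableAt 𝓘(ℝ, VG) 𝓘(ℝ, VP) (fun g => B.R g u')
      ((extChartAt 𝓘(ℝ, VG) (1 : G)).symm (extChartAt 𝓘(ℝ, VG) (1 : G) 1)) :=
    (B.contMDiff_R_right u' _).mdifferentiableAt (by simp)
  have hφ : MDifferentiableAt 𝓘(ℝ, VP) 𝓘(ℝ, VP) (extChartAt 𝓘(ℝ, VP) u)
      (B.R ((extChartAt 𝓘(ℝ, VG) (1 : G)).symm (extChartAt 𝓘(ℝ, VG) (1 : G) 1)) u') := by
    rw [extChartAt_to_inv, B.R_one]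
    exact (contMDiffAt_extChartAt_of_mem_source u hsrc).mdifferentiableAt (by simp)
  have h2 := mfderiv_comp (g := extChartAt 𝓘(ℝ, VP) u)
    (f := (fun g => B.R g u') ∘ (extChartAt 𝓘(ℝ, VG) (1 : G)).symm) _ hφ (hR.comp _ hχ)
  rw [mfderiv_comp _ hR hχ] at h2
  have h3 : fderiv ℝ (B.actionInChart u) (extChartAt 𝓘(ℝ, VG) (1 : G) 1, y) (A, 0) =
      mfderiv 𝓘(ℝ, VG) 𝓘(ℝ, VP) (fun z => B.actionInChart u (z, y))
        (extChartAt 𝓘(ℝ, VG) (1 : G) 1) A := by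
    rw [mfderiv_eq_fderiv, h1.fderiv]
    rfl
  refine h3.trans ((DFunLike.congr_fun h2 A).trans ?_)
  have h4 : ∀ (g : G) (w : VP) (A A' : VG), g = 1 → A = A' →
      mfderiv 𝓘(ℝ, VP) 𝓘(ℝ, VP) (extChartAt 𝓘(ℝ, VP) u) (B.R g u')
        (mfderiv 𝓘(ℝ, VG) 𝓘(ℝ, VP) (fun g => B.R g u') g A) =
      mfderiv 𝓘(ℝ, VP) 𝓘(ℝ, VP) (extChartAt 𝓘(ℝ, VP) u) u' (B.fund u' A') := by
    rintro _ _ A _ rfl rfl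
    rw [B.R_one]
    rfl
  exact h4 _ 0 _ _ (extChartAt_to_inv (1 : G))
    (mfderiv_extChartAt_symm_self_apply (V := VG) (1 : G) A)

/-- In the charts, equivariance of a form says that it is preserved by the action up to `▷`. -/
theorem IsEquivariant.chartRep_actionInChart {C : LieCrossedModule VG G VE E}
    {a : DForm VP P n (LieAlg VE E)} (ha : B.IsEquivariant C a) {u : P} {p : VG × VP}
    (h1 : p.1 ∈ (extChartAt 𝓘(ℝ, VG) (1 : G)).target) (h2 : p.2 ∈ (extChartAt 𝓘(ℝ, VP) u).target)
    (h3 : B.R ((extChartAt 𝓘(ℝ, VG) (1 : G)).symm p.1) ((extChartAt 𝓘(ℝ, VP) u).symm p.2) ∈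
      (extChartAt 𝓘(ℝ, VP) u).source) (v : Fin n → VP) :
    C.groupAct ((extChartAt 𝓘(ℝ, VG) (1 : G)).symm p.1) (a.chartRep u (B.actionInChart u p)
      fun i => fderiv ℝ (B.actionInChart u) p (0, v i)) = a.chartRep u p.2 v := by
  obtain ⟨z, y⟩ := p
  set φ := extChartAt 𝓘(ℝ, VP) u with hφ
  set g := (extChartAt 𝓘(ℝ, VG) (1 : G)).symm z with hg
  set ψ : VP → VP := fun y => B.actionInChart u (z, y) with hψ
  have hd : DifferentiableAt ℝ (B.actionInChart u) (z, y) :=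
    (B.contDiffAt_actionInChart h1 h2 h3).differentiableAt (by simp)
  have hψd : HasFDerivAt ψ ((fderiv ℝ (B.actionInChart u) (z, y)).comp
      (ContinuousLinearMap.inr ℝ VG VP)) y :=
    HasFDerivAt.comp _ hd.hasFDerivAt (hasFDerivAt_prodMk_right _ _)
  have hsymm : MDifferentiableAt 𝓘(ℝ, VP) 𝓘(ℝ, VP) φ.symm y :=
    (contMDiffAt_extChartAt_symm u h2).mdifferentiableAt (by simp)
  have hRd : MDifferentiableAt 𝓘(ℝ, VP) 𝓘(ℝ, VP) (B.R g) (φ.symm y) :=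
    (B.contMDiff_R_left g _).mdifferentiableAt (by simp)
  have hsymm' : MDifferentiableAt 𝓘(ℝ, VP) 𝓘(ℝ, VP) φ.symm (ψ y) :=
    (contMDiffAt_extChartAt_symm u (φ.map_source h3)).mdifferentiableAt (by simp)
  have hcomp : φ.symm ∘ ψ =ᶠ[𝓝 y] B.R g ∘ φ.symm := by
    have hc : ContinuousAt (B.R g ∘ φ.symm) y :=
      hRd.continuousAt.comp hsymm.continuousAt
    filter_upwards [hc.eventually_mem ((isOpen_extChartAt_source u).mem_nhds h3)] with y' hy'
    exact φ.left_inv hy'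
  have hpull : DForm.pullback (V := VP) (X := VP) ψ (a.chartRep u) y =
      (DForm.pullback (V := VP) (B.R g) a).chartRep u y := by
    rw [DForm.chartRep_eq_pullback, DForm.chartRep_eq_pullback, ← DForm.pullback_comp _ _ _ _ hRd
      hsymm, ← DForm.pullback_congr a hcomp]
    exact (DForm.pullback_comp _ _ _ _ hsymm' hψd.differentiableAt.mdifferentiableAt).symm
  rw [DForm.pullback_vectorSpace, ha g, hψd.fderiv] at hpull
  have hv := DFunLike.congr_fun hpull v
  refine (congrArg (C.groupAct g) hv).trans ?_
  change C.groupAct g (C.groupAct g⁻¹ (a.chartRep u y v)) = _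
  rw [← C.groupAct_mul_apply, mul_inv_cancel, C.groupAct_one]
  rfl

variable [IsManifold 𝓘(ℝ, VE) ∞ E] {C : LieCrossedModule VG G VE E}
  {θ : DForm VP P 1 (LieAlg VG G)}

/-- Since a horizontal form is annihilated by the fundamental vector fields, Cartan's formula
identifies the contraction of its exterior derivative with `A^#` with its Lie derivative along
`A^#`, which by equivariance is `-(A ▷ a)`. -/
theorem d_cons_fund (hθ : B.IsConnection θ) {a : DForm VP P n (LieAlg VE E)} (hs : a.IsSmooth)
    (he : B.IsEquivariant C a) (hh : B.IsHorizontal θ a) (u : P) (A : LieAlg VG G)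
    (v : Fin n → TangentSpace 𝓘(ℝ, VP) u) :
    a.d u (Fin.cons (B.fund u A) v) = -(C.lieAct A (a u v)) := by
  have hy₀ := mem_extChartAt_target (I := 𝓘(ℝ, VP)) u
  have hT : DifferentiableAt ℝ (fun z => C.groupAct ((extChartAt 𝓘(ℝ, VG) (1 : G)).symm z))
      (extChartAt 𝓘(ℝ, VG) (1 : G) 1) :=
    (ContMDiffAt.comp _ (C.contMDiff_groupAct _) (contMDiffAt_extChartAt_symm (1 : G)
      (mem_extChartAt_target _))).contDiffAt.differentiableAt (by simp)
  have hdom := B.eventually_mem_actionInChart_domain u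
  have h := extDeriv_cons_of_equivariant (a.chartRep u) (B.actionInChart u)
    (fun z => C.groupAct ((extChartAt 𝓘(ℝ, VG) (1 : G)).symm z))
    (extChartAt 𝓘(ℝ, VG) (1 : G) 1) (extChartAt 𝓘(ℝ, VP) u u) A (hs.differentiableAt_chartRep u)
    (B.contDiffAt_actionInChart hdom.self_of_nhds.1 hdom.self_of_nhds.2.1 hdom.self_of_nhds.2.2)
    (Filter.mem_of_superset (extChartAt_target_mem_nhds u) fun y hy => B.actionInChart_base hy)
    hT (by rw [extChartAt_to_inv, C.groupAct_one])
    (hdom.mono fun p hp v => he.chartRep_actionInChart B hp.1 hp.2.1 hp.2.2 v)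
    (by
      filter_upwards [extChartAt_target_mem_nhds u] with y hy w hw
      obtain ⟨i, hi⟩ := hw
      refine hh.apply_eq_zero B hθ ((extChartAt 𝓘(ℝ, VP) u).symm y) A _ ⟨i, ?_⟩
      rw [B.fderiv_actionInChart_inl hy] at hi
      exact (congrArg _ hi).trans (mfderiv_extChartAt_symm_comp_apply u hy _))
    v
  have hξ : fderiv ℝ (B.actionInChart u)
      (extChartAt 𝓘(ℝ, VG) (1 : G) 1, extChartAt 𝓘(ℝ, VP) u u) (A, 0) = B.fund u A := by
    refine (B.fderiv_actionInChart_inl hy₀ A).trans ?_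
    rw [extChartAt_to_inv]
    exact mfderiv_extChartAt_self_apply u _
  rw [hξ, C.fderiv_groupAct_extChartAt_symm] at h
  refine (DForm.d_apply a u _).trans (h.trans ?_)
  exact congrArg (fun x => -(C.lieAct A x)) (DForm.chartRep_self_apply a u v)

/-- The form `da + θ ∧ a` is annihilated by the fundamental vector fields, so it agrees with its
own horizontal part; and `θ ∧ a` has no horizontal part. -/
theorem covD_eq (hθ : B.IsConnection θ) {a : DForm VP P n (LieAlg VE E)} (hs : a.IsSmooth)
    (he : B.IsEquivariant C a) (hh : B.IsHorizontal θ a) :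
    B.covD θ a = a.d + DForm.wedge C.lieAct θ a (Nat.add_comm 1 n) := by
  funext u
  ext v
  have hK := (a.d u + DForm.wedge C.lieAct θ a (Nat.add_comm 1 n) u).map_sub_comp_eq_of_cons_eq_zero
    (fun w => B.fund u (θ.toLin u w)) (fun w v => by
      rw [ContinuousAlternatingMap.add_apply, B.d_cons_fund hθ hs he hh,
        DForm.wedge_one_apply_cons _ _ _ _ _ (hh.apply_eq_zero B hθ u _), B.toLin_fund hθ]
      exact neg_add_cancel _) v
  rw [ContinuousAlternatingMap.add_apply, DForm.wedge_one_apply_eq_zero, add_zero] at hK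
  · exact hK
  · exact fun i => B.apply_horProj hθ u (v i)

omit [IsManifold 𝓘(ℝ, VE) ∞ E] in
/-- The exterior derivative commutes with pull-backs and with `g⁻¹ ▷ ·`, and the horizontal
projection commutes with the right action. -/
theorem IsEquivariant.covD (hθ : B.IsConnection θ) {a : DForm VP P n (LieAlg VE E)}
    (hs : a.IsSmooth) (he : B.IsEquivariant C a) : B.IsEquivariant C (B.covD θ a) := by
  intro g
  have hd : DForm.pullback (V := VP) (B.R g) a.d = a.d.map (C.groupAct g⁻¹) := by
    rw [← DForm.d_pullback (B.contMDiff_R_left g) hs, he g, DForm.d_map _ hs]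
  funext u
  ext v
  refine Eq.trans ?_ (DFunLike.congr_fun (congrFun hd u) fun i => B.horProj θ u (v i))
  exact congrArg (a.d (B.R g u)) (funext fun i => (B.mfderiv_R_horProj hθ g u (v i)).symm)

end SmoothPrincipalBundle

theorem mainTheorem5
    {VG : Type*} [NormedAddCommGroup VG] [NormedSpace ℝ VG] [FiniteDimensional ℝ VG]
    {G : Type*} [TopologicalSpace G] [ChartedSpace VG G] [Group G] [LieGroup 𝓘(ℝ, VG) ∞ G]
    {VE : Type*} [NormedAddCommGroup VE] [NormedSpace ℝ VE] [FiniteDimensional ℝ VE]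
    {E : Type*} [TopologicalSpace E] [ChartedSpace VE E] [Group E] [LieGroup 𝓘(ℝ, VE) ∞ E]
    {VM : Type*} [NormedAddCommGroup VM] [NormedSpace ℝ VM] [FiniteDimensional ℝ VM]
    {M : Type*} [TopologicalSpace M] [ChartedSpace VM M] [IsManifold 𝓘(ℝ, VM) ∞ M]
    {VP : Type*} [NormedAddCommGroup VP] [NormedSpace ℝ VP] [FiniteDimensional ℝ VP]
    {P : Type*} [TopologicalSpace P] [ChartedSpace VP P] [IsManifold 𝓘(ℝ, VP) ∞ P]
    (C : LieCrossedModule VG G VE E) (B : SmoothPrincipalBundle VG G VM M VP P)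
    (θ : DForm VP P 1 (LieAlg VG G)) :
    (∀ m : DForm VP P 2 (LieAlg VE E), B.IsCategoricalConnection C θ m →
      B.twoCurvature θ m = m.d + DForm.wedge C.lieAct θ m (Nat.add_comm 1 2) ∧
      B.IsEquivariant C (B.twoCurvature θ m)) ∧
    (B.IsConnection θ → ∀ (n : ℕ) (a : DForm VP P n (LieAlg VE E)),
      a.IsSmooth → B.IsEquivariant C a → B.IsHorizontal θ a →
      B.covD θ a = a.d + DForm.wedge C.lieAct θ a (Nat.add_comm 1 n)) := by
  refine ⟨fun m hm => ⟨B.covD_eq hm.isConnection hm.smooth hm.equivariant hm.horizontal,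
    hm.equivariant.covD B hm.isConnection hm.smooth⟩, fun hθ n a hs he hh => B.covD_eq hθ hs he hh⟩
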